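/- Let $\mathbb{Z}^2$ denote the square lattice graph: its vertices are the points of $\mathbb{Z}\times\mathbb{Z}$, and two vertices are adjacent if and only if their $\ell^1$-distance is $1$. A bond percolation model on a graph $G$ is a probability distribution on the spanning subgraphs of $G$ (equivalently, on $\{\text{open},\text{closed}\}^{E(G)}$ with the product $\sigma$-algebra). It is 1-independent if, for any two sets of edges $S_1,S_2\subseteq E(G)$ such that no edge of $S_1$ shares a vertex with an edge of $S_2$, the states of the edges in $S_1$ are independent of the states of the edges in $S_2$. For an infinite graph $G$, the model percolates if, with positive probability, the random subgraph formed by the open edges has an infinite connected component. For real $p$, let $\mathcal{D}_{\ge p}(G)$ be the class of 1-independent bond percolation models on $G$ in which each edge is open with probability at least $p$, and define \[ p_{\max}(G)=\sup\{p : \text{some model in } \mathcal{D}_{\ge p}(G) \text{ does not percolate}\}. \] **Theorem.** Every model in $\mathcal{D}_{\ge 0.8457}(\mathbb{Z}^2)$ percolates. Consequently \[ p_{\max}(\mathbb{Z}^2)\le 0.8457. \] -/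

import Mathlib

open MeasureTheory ProbabilityTheory

namespace Percolation

/-- The square lattice on `ℤ × ℤ`: two sites are adjacent iff their `ℓ¹`-distance is `1`. -/
def squareLattice : SimpleGraph (ℤ × ℤ) where
  Adj u v := |u.1 - v.1| + |u.2 - v.2| = 1
  symm := ⟨fun u v h => by rwa [abs_sub_comm v.1, abs_sub_comm v.2]⟩
  loopless := ⟨fun u h => by simp at h⟩

variable {V : Type*}

/-- A bond configuration on `G`, i.e. a spanning subgraph of `G`: `true` means open, `false`
means closed. It carries the product σ-algebra. -/
abbrev BondConfig (G : SimpleGraph V) : Type _ := G.edgeSet → Bool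

/-- The spanning subgraph of `G` whose edges are the open edges of `ω`. -/
def openSubgraph {G : SimpleGraph V} (ω : BondConfig G) : SimpleGraph V where
  Adj u v := ∃ h : s(u, v) ∈ G.edgeSet, ω ⟨s(u, v), h⟩ = true
  symm := ⟨fun u v h => by rwa [Sym2.eq_swap]⟩
  loopless := ⟨fun u h => by
    obtain ⟨h, -⟩ := h
    exact G.irrefl (G.mem_edgeSet.mp h)⟩

/-- A bond percolation model on `G`: a probability distribution on bond configurations. -/
abbrev BondModel (G : SimpleGraph V) : Type _ := ProbabilityMeasure (BondConfig G)

/-- 1-independence: the states of the edges in `S₁` are independent of the states of the edges in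
`S₂` whenever no edge of `S₁` shares a vertex with an edge of `S₂` (so that `S₁` and `S₂` are in
particular disjoint). The sets may be infinite. -/
def IsOneIndependent {G : SimpleGraph V} (μ : BondModel G) : Prop :=
  ∀ S₁ S₂ : Set G.edgeSet,
    (∀ e ∈ S₁, ∀ f ∈ S₂, ∀ v : V, v ∈ (e : Sym2 V) → v ∉ (f : Sym2 V)) →
      IndepFun (fun (ω : BondConfig G) (e : S₁) => ω e) (fun (ω : BondConfig G) (f : S₂) => ω f)
        (μ : Measure (BondConfig G))

/-- The class `𝒟_{≥ p}(G)` of 1-independent bond percolation models on `G` in which each edge is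
open with probability at least `p`. -/
def oneIndependentModels (G : SimpleGraph V) (p : ℝ) : Set (BondModel G) :=
  {μ | IsOneIndependent μ ∧
    ∀ e : G.edgeSet, p ≤ (μ : Measure (BondConfig G)).real {ω | ω e = true}}

/-- The model percolates: with positive probability, the open subgraph has an infinite
connected component. -/
def Percolates {G : SimpleGraph V} (μ : BondModel G) : Prop :=
  0 < (μ : Measure (BondConfig G))
    {ω | ∃ C : (openSubgraph ω).ConnectedComponent, C.supp.Infinite}

/-- `p_max(G)`, the supremum of the `p` for which some model in `𝒟_{≥ p}(G)` does not percolate. -/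
noncomputable def pMax (G : SimpleGraph V) : ℝ :=
  sSup {p : ℝ | ∃ μ ∈ oneIndependentModels G p, ¬ Percolates μ}

end Percolation

/-!
Peierls' argument. Suppose that all open clusters are finite, and let `S` be the union of the
clusters that meet a long initial segment of the nonnegative horizontal axis. The edges that leave
`S` are closed, and their duals form a finite even subgraph of the dual lattice. By parity, some
component of this subgraph meets the axis on both sides of the origin, so it contains a dual path
that is at least as long as the distance of its first edge from the origin. Edges of a dual path may
share vertices. Leaving the neighbourhood of each edge for good at the last visit thins the path
out to an escaping sequence, in which no two edges share a vertex, and so 1-independence bounds the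
probability that all its edges are closed by a power of `1 - p`. A finite check shows that an
escaping sequence of at least two edges extends by three further edges in at most `261` ways, so if
`261 * (1 - p) ^ 3 < 1` the probabilities are summable and the Borel–Cantelli lemma applies.
-/

namespace Percolation

open Function (HasFiniteSupport)

section
variable {V : Type*} {G : SimpleGraph V}

theorem oneIndependentModels_anti : Antitone (oneIndependentModels G) :=
  fun _ _ h _ hμ => ⟨hμ.1, fun e => h.trans (hμ.2 e)⟩

theorem pMax_le {p : ℝ} (hp : 0 ≤ p) (h : ∀ μ ∈ oneIndependentModels G p, Percolates μ) :
    pMax G ≤ p := by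
  refine Real.sSup_le ?_ hp
  rintro q ⟨μ, hμ, hnot⟩
  by_contra! hpq
  exact hnot (h μ (oneIndependentModels_anti hpq.le hμ))

theorem percolates_of_ae {μ : BondModel G} (h : ∀ᵐ ω ∂(μ : Measure (BondConfig G)),
    ∃ C : (openSubgraph ω).ConnectedComponent, C.supp.Infinite) : Percolates μ :=
  pos_iff_ne_zero.2 fun h0 =>
    let ⟨_, hinf, hnot⟩ := (h.and (measure_eq_zero_iff_ae_notMem.1 h0)).exists
    hnot hinf

theorem measurableSet_eq_false {ι : Type*} (i : ι) : MeasurableSet {x : ι → Bool | x i = false} :=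
  measurableSet_eq_fun (measurable_pi_apply i) measurable_const

theorem real_closed_le {μ : BondModel G} {p : ℝ} (hμ : μ ∈ oneIndependentModels G p)
    (e : G.edgeSet) : (μ : Measure (BondConfig G)).real {ω | ω e = false} ≤ 1 - p := by
  have hcompl : {ω : BondConfig G | ω e = true} = {ω | ω e = false}ᶜ := by
    ext ω
    simp
  have hopen := hμ.2 e
  rw [hcompl, probReal_compl_eq_one_sub (measurableSet_eq_false e)] at hopen
  linarith

theorem real_forall_closed_le {μ : BondModel G} {p : ℝ} (hμ : μ ∈ oneIndependentModels G p)
    {l : List G.edgeSet}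
    (hl : l.Pairwise fun (e f : G.edgeSet) => ∀ v : V, v ∈ (e : Sym2 V) → v ∉ (f : Sym2 V)) :
    (μ : Measure (BondConfig G)).real {ω | ∀ e ∈ l, ω e = false} ≤ (1 - p) ^ l.length := by
  induction l with
  | nil => simp
  | cons e l ih =>
    rw [List.pairwise_cons] at hl
    let S₁ : Set G.edgeSet := {e}
    let S₂ : Set G.edgeSet := {f | f ∈ l}
    have hind := hμ.1 S₁ S₂ fun f hf g hg => by
      rw [Set.mem_singleton_iff.1 hf]
      exact hl.1 g hg
    let A : Set (S₁ → Bool) := {x | x ⟨e, rfl⟩ = false}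
    let B : Set (S₂ → Bool) := ⋂ f, {x | x f = false}
    have hB : MeasurableSet B :=
      have : Countable S₂ := l.finite_toSet.countable
      .iInter measurableSet_eq_false
    have hsplit : {ω : BondConfig G | ∀ f ∈ e :: l, ω f = false} =
        (fun ω (f : S₁) => ω f) ⁻¹' A ∩ (fun ω (f : S₂) => ω f) ⁻¹' B := by
      ext ω
      simp [A, B, S₂]
    have htail : (fun (ω : BondConfig G) (f : S₂) => ω f) ⁻¹' B = {ω | ∀ f ∈ l, ω f = false} := by
      ext ω
      simp [B, S₂]
    calc (μ : Measure (BondConfig G)).real {ω | ∀ f ∈ e :: l, ω f = false}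
        = (μ : Measure (BondConfig G)).real {ω | ω e = false} *
            (μ : Measure (BondConfig G)).real {ω | ∀ f ∈ l, ω f = false} := by
          rw [hsplit, Measure.real,
            hind.measure_inter_preimage_eq_mul A B (measurableSet_eq_false _) hB,
            ENNReal.toReal_mul, htail]
          rfl
      _ ≤ (1 - p) * (1 - p) ^ l.length :=
          mul_le_mul (real_closed_le hμ e) (ih hl.2) measureReal_nonneg
            (measureReal_nonneg.trans (real_closed_le hμ e))
      _ = (1 - p) ^ (e :: l).length := (pow_succ' _ _).symm
end

theorem exists_last_exit {α : Type*} {r : α → α → Prop} {P : α → Prop}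
    {a b : α} (h : Relation.ReflTransGen r a b) (ha : P a) (hb : ¬ P b) :
    ∃ c d, Relation.ReflTransGen r a c ∧ P c ∧ r c d ∧ ¬ P d ∧
      Relation.ReflTransGen (fun x y => r x y ∧ ¬ P y) d b := by
  induction h with
  | refl => exact absurd ha hb
  | @tail x y hax hxy ih =>
    by_cases hx : P x
    · exact ⟨x, y, hax, hx, hxy, hb, .refl⟩
    · obtain ⟨c, d, hac, hc, hcd, hd, hdx⟩ := ih hx
      exact ⟨c, d, hac, hc, hcd, hd, hdx.tail ⟨hxy, hb⟩⟩

theorem finsum_add_one_sub {M : Type*} [AddCommGroup M] {u : ℤ → M} (hu : HasFiniteSupport u) :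
    ∑ᶠ x, (u (x + 1) - u x) = 0 := by
  rw [finsum_sub_distrib (hu.fun_comp_of_injective (add_left_injective 1)) hu, sub_eq_zero]
  exact finsum_comp_equiv (Equiv.addRight (1 : ℤ))

/-- An edge of the square lattice, given by its left or lower end and its direction: `(v, false)`
is horizontal and `(v, true)` is vertical. -/
abbrev GridEdge : Type := (ℤ × ℤ) × Bool

namespace GridEdge

/-- The unit vector along an edge. -/
def dir (e : GridEdge) : ℤ × ℤ := bif e.2 then (0, 1) else (1, 0)

/-- The left or lower end of an edge. -/
def src (e : GridEdge) : ℤ × ℤ := e.1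

/-- The right or upper end of an edge. -/
def tgt (e : GridEdge) : ℤ × ℤ := e.1 + e.dir

/-- `e` and `f` share a vertex. -/
def Touch (e f : GridEdge) : Prop :=
  e.src = f.src ∨ e.src = f.tgt ∨ e.tgt = f.src ∨ e.tgt = f.tgt

/-- The edges that bound the unit face with lower left corner `c`. -/
def face (c : ℤ × ℤ) : Finset GridEdge :=
  {(c, false), (c + (0, 1), false), (c, true), (c + (1, 0), true)}

/-- `e` and `f` bound a common unit face, i.e. the dual edges share a vertex. -/
def Link (e f : GridEdge) : Prop := ∃ c, e ∈ face c ∧ f ∈ face c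

/-- `f` lies in the union of the six unit faces that contain an end of `e`. For the product order
on `ℤ × ℤ`, this union is the rectangle `[e.src - 1, e.tgt + 1]`. -/
def Near (e f : GridEdge) : Prop := e.src - 1 ≤ f.src ∧ f.tgt ≤ e.tgt + 1

instance : DecidableRel Near := fun _ _ => inferInstanceAs (Decidable (_ ∧ _))

/-- The edges on the boundary of the rectangle `[e.src - 1, e.tgt + 1]`: six are parallel to `e`
and four are perpendicular. -/
def rim : GridEdge → Finset GridEdge
  | ((x, y), false) =>
    {((x - 1, y + 1), false), ((x, y + 1), false), ((x + 1, y + 1), false),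
      ((x - 1, y - 1), false), ((x, y - 1), false), ((x + 1, y - 1), false),
      ((x - 1, y), true), ((x - 1, y - 1), true), ((x + 2, y), true), ((x + 2, y - 1), true)}
  | ((x, y), true) =>
    {((x + 1, y - 1), true), ((x + 1, y), true), ((x + 1, y + 1), true),
      ((x - 1, y - 1), true), ((x - 1, y), true), ((x - 1, y + 1), true),
      ((x, y - 1), false), ((x - 1, y - 1), false), ((x, y + 2), false), ((x - 1, y + 2), false)}

theorem touch_self (e : GridEdge) : Touch e e := .inl rfl

theorem mem_rim {e f : GridEdge} : f ∈ rim e ↔ Near e f ∧ ¬ Touch e f := by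
  obtain ⟨⟨x, y⟩, s⟩ := e
  obtain ⟨⟨x', y'⟩, t⟩ := f
  cases s <;> cases t <;>
    simp [rim, Near, Touch, src, tgt, dir, Prod.le_def, Prod.ext_iff] <;> omega

theorem bounds_of_mem_face {c : ℤ × ℤ} {e : GridEdge} (he : e ∈ face c) :
    c ≤ e.src ∧ e.tgt ≤ c + 1 := by
  simp only [face, Finset.mem_insert, Finset.mem_singleton] at he
  rcases he with rfl | rfl | rfl | rfl <;> simp [src, tgt, dir, Prod.le_def]

theorem src_le_tgt (e : GridEdge) : e.src ≤ e.tgt := by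
  obtain ⟨v, s⟩ := e
  cases s <;> simp [src, tgt, dir, Prod.le_def]

theorem Touch.exists_vertex {e f : GridEdge} (h : Touch e f) :
    ∃ v, (e.src ≤ v ∧ v ≤ e.tgt) ∧ f.src ≤ v ∧ v ≤ f.tgt := by
  have he := e.src_le_tgt
  have hf := f.src_le_tgt
  rcases h with h | h | h | h
  · exact ⟨_, ⟨le_rfl, he⟩, h.ge, h.trans_le hf⟩
  · exact ⟨_, ⟨le_rfl, he⟩, hf.trans h.ge, h.le⟩
  · exact ⟨_, ⟨he, le_rfl⟩, h.ge, h.trans_le hf⟩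
  · exact ⟨_, ⟨he, le_rfl⟩, hf.trans h.ge, h.le⟩

theorem Touch.near_of_link {e f g : GridEdge} (h : Touch e f) (hfg : Link f g) : Near e g := by
  obtain ⟨v, ⟨hev, hve⟩, hfv, hvf⟩ := h.exists_vertex
  obtain ⟨c, hcf, hcg⟩ := hfg
  obtain ⟨hcf, hfc⟩ := bounds_of_mem_face hcf
  obtain ⟨hcg, hgc⟩ := bounds_of_mem_face hcg
  constructor
  · exact (sub_le_iff_le_add.2 (hev.trans (hvf.trans hfc))).trans hcg
  · exact hgc.trans (add_le_add_left (hcf.trans (hfv.trans hve)) 1)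

theorem link_self (e : GridEdge) : Link e e := by
  have he : e ∈ face e.src := by
    obtain ⟨v, s⟩ := e
    cases s <;> simp [face, src]
  exact ⟨e.src, he, he⟩

theorem Touch.near {e f : GridEdge} (h : Touch e f) : Near e f := h.near_of_link f.link_self

theorem Near.sub_one_le {e f : GridEdge} (h : Near e f) : e.src.1 - 1 ≤ f.src.1 := h.1.1

/-! ### Escaping sequences -/

/-- A sequence of edges each of which lies on the rim of its predecessor and is not near any
earlier edge. -/
def Escaping : List GridEdge → Prop
  | [] => True
  | [_] => True
  | e :: f :: l => f ∈ rim e ∧ (∀ g ∈ l, ¬ Near e g) ∧ Escaping (f :: l)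

theorem Escaping.tail {e : GridEdge} {l : List GridEdge} (h : Escaping (e :: l)) :
    Escaping l := by
  cases l with
  | nil => trivial
  | cons f l => exact h.2.2

theorem Escaping.not_touch {e : GridEdge} {l : List GridEdge} (h : Escaping (e :: l)) :
    ∀ f ∈ l, ¬ Touch e f := by
  cases l with
  | nil => simp
  | cons f l =>
    exact List.forall_mem_cons.2 ⟨(mem_rim.1 h.1).2, fun g hg hT => h.2.1 g hg hT.near⟩

theorem Escaping.pairwise_not_touch {l : List GridEdge} (h : Escaping l) :
    l.Pairwise fun e f => ¬ Touch e f := by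
  induction l with
  | nil => exact .nil
  | cons e l ih => exact .cons h.not_touch (ih h.tail)

theorem Escaping.take {l : List GridEdge} (h : Escaping l) (n : ℕ) : Escaping (l.take n) := by
  induction l generalizing n with
  | nil => simp [Escaping]
  | cons e l ih =>
    match n, l with
    | 0, _ => trivial
    | 1, _ => trivial
    | _ + 2, [] => trivial
    | n + 2, f :: l =>
      exact ⟨h.1, fun g hg => h.2.1 g (List.mem_of_mem_take hg), ih h.tail (n + 1)⟩

theorem Escaping.sub_length_le_getLast {e : GridEdge} {l : List GridEdge}
    (h : Escaping (e :: l)) :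
    e.src.1 - l.length ≤ ((e :: l).getLast (List.cons_ne_nil e l)).src.1 := by
  induction l generalizing e with
  | nil => simp
  | cons f l ih =>
    have hef := (mem_rim.1 h.1).1.sub_one_le
    have hlast := ih h.tail
    rw [List.getLast_cons_cons, List.length_cons]
    push_cast
    linarith

theorem exists_rim_of_reachable {A : Set GridEdge} {e z : GridEdge}
    (h : Relation.ReflTransGen (fun x y => Link x y ∧ y ∈ A) e z) (hz : ¬ Near e z) :
    ∃ f ∈ A, f ∈ rim e ∧
      Relation.ReflTransGen (fun x y => Link x y ∧ y ∈ A \ {g | Near e g}) f z := by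
  obtain ⟨f, g, hef, hnf, hfg, hng, hgz⟩ := exists_last_exit h (touch_self e).near hz
  have htouch : ¬ Touch e f := fun ht => hng (ht.near_of_link hfg.1)
  have hfA : f ∈ A := by
    rcases hef.cases_tail with rfl | ⟨_, _, -, hf⟩
    · exact absurd (touch_self f) htouch
    · exact hf
  simp only [and_assoc] at hgz
  exact ⟨f, hfA, mem_rim.2 ⟨hnf, htouch⟩, .head ⟨hfg.1, hfg.2, hng⟩ hgz⟩

-- Always leave `e` for good at the last edge near `e`: what follows avoids the neighbourhood of
-- `e`, so that fewer edges remain for the induction.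
theorem exists_escaping_of_reachable {A : Set GridEdge} (hA : A.Finite) {e z : GridEdge}
    (h : Relation.ReflTransGen (fun x y => Link x y ∧ y ∈ A) e z) :
    ∃ l : List GridEdge, (∀ f ∈ l, f ∈ A) ∧ Escaping (e :: l) ∧
      Near ((e :: l).getLast (List.cons_ne_nil e l)) z := by
  induction hn : A.ncard using Nat.strong_induction_on generalizing A e with
  | _ n ih =>
    subst hn
    by_cases hz : Near e z
    · exact ⟨[], by simp, trivial, hz⟩
    obtain ⟨f, hfA, hf, hfz⟩ := exists_rim_of_reachable h hz
    have hlt : (A \ {g | Near e g}).ncard < A.ncard :=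
      Set.ncard_lt_ncard (Set.sdiff_ssubset_left_iff.2 ⟨f, hfA, (mem_rim.1 hf).1⟩) hA
    obtain ⟨l, hl, hesc, hlast⟩ := ih _ hlt hA.sdiff hfz rfl
    exact ⟨f :: l, List.forall_mem_cons.2 ⟨hfA, fun g hg => (hl g hg).1⟩,
      ⟨hf, fun g hg => (hl g hg).2, hesc⟩, hlast⟩

/-! ### Counting escaping sequences -/

/-- The edges on the rim of `e` that are not near any edge of `h`: the possible successors of `e`
in an escaping sequence, when `h` lists some of the edges before `e`. -/
def nextEdges (h : List GridEdge) (e : GridEdge) : Finset GridEdge :=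
  {f ∈ rim e | ∀ g ∈ h, ¬ Near g f}

/-- The lists `l` of length `n` for which `e :: l` is escaping and no edge of `l` is near an edge
of `h`. -/
def extensions : ℕ → List GridEdge → GridEdge → Finset (List GridEdge)
  | 0, _, _ => {[]}
  | n + 1, h, e => (nextEdges h e).biUnion fun f => (extensions n (e :: h) f).image (f :: ·)

theorem mem_extensions {n : ℕ} {h : List GridEdge} {e : GridEdge} {l : List GridEdge} :
    l ∈ extensions n h e ↔
      l.length = n ∧ Escaping (e :: l) ∧ ∀ f ∈ l, ∀ g ∈ h, ¬ Near g f := by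
  induction n generalizing h e l with
  | zero =>
    simp only [extensions, Finset.mem_singleton, List.length_eq_zero_iff]
    exact ⟨by rintro rfl; simp [Escaping], fun h => h.1⟩
  | succ n ih =>
    cases l with
    | nil => simp [extensions]
    | cons f l =>
      simp only [extensions, nextEdges, Finset.mem_biUnion, Finset.mem_filter, Finset.mem_image,
        ih, List.cons.injEq, List.length_cons, Nat.add_right_cancel_iff, Escaping,
        List.forall_mem_cons]
      constructor
      · rintro ⟨f, ⟨hf, hfh⟩, l, ⟨hn, hesc, hl⟩, rfl, rfl⟩
        exact ⟨hn, ⟨hf, fun g hg => (hl g hg).1, hesc⟩, hfh, fun g hg => (hl g hg).2⟩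
      · rintro ⟨hn, ⟨hf, hl, hesc⟩, hfh, hlh⟩
        exact ⟨f, ⟨hf, hfh⟩, l, ⟨hn, hesc, fun g hg => ⟨hl g hg, hlh g hg⟩⟩, rfl, rfl⟩

theorem card_extensions_succ (n : ℕ) (h : List GridEdge) (e : GridEdge) :
    (extensions (n + 1) h e).card = ∑ f ∈ nextEdges h e, (extensions n (e :: h) f).card := by
  rw [extensions, Finset.card_biUnion]
  · exact Finset.sum_congr rfl fun f _ => Finset.card_image_of_injective _ (List.cons_injective)
  · intro f _ f' _ hne
    refine Finset.disjoint_left.2 fun l hl hl' => hne ?_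
    obtain ⟨_, -, rfl⟩ := Finset.mem_image.1 hl
    obtain ⟨_, -, heq⟩ := Finset.mem_image.1 hl'
    exact (List.cons.inj heq).1.symm

theorem card_extensions_mono {n : ℕ} {h h' : List GridEdge} (hh : h' ⊆ h) (e : GridEdge) :
    (extensions n h e).card ≤ (extensions n h' e).card := by
  refine Finset.card_le_card fun l hl => ?_
  obtain ⟨hn, hesc, hlh⟩ := mem_extensions.1 hl
  exact mem_extensions.2 ⟨hn, hesc, fun f hf g hg => hlh f hf g (hh hg)⟩

-- Only the last edge before the final `n` steps is remembered in the second factor.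
theorem card_extensions_add_le {n N : ℕ}
    (hN : ∀ e, ∀ f ∈ rim e, (extensions n [e] f).card ≤ N) (k : ℕ) (h : List GridEdge)
    (e : GridEdge) :
    (extensions (n + (k + 1)) h e).card ≤ (extensions (k + 1) h e).card * N := by
  rw [← add_assoc, card_extensions_succ, card_extensions_succ, Finset.sum_mul]
  refine Finset.sum_le_sum fun f hf => ?_
  cases k with
  | zero =>
    have hmono := card_extensions_mono (n := n) (List.cons_subset_cons e h.nil_subset) f
    simpa [extensions] using hmono.trans (hN e f (Finset.mem_filter.1 hf).1)
  | succ k => exact card_extensions_add_le hN k (e :: h) f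

/-- Translation of edges by a vector. -/
def translate (v : ℤ × ℤ) : GridEdge ≃ GridEdge := (Equiv.addLeft v).prodCongr (.refl _)

theorem src_translate (v : ℤ × ℤ) (e : GridEdge) : (translate v e).src = v + e.src := rfl

theorem tgt_translate (v : ℤ × ℤ) (e : GridEdge) : (translate v e).tgt = v + e.tgt :=
  add_assoc v e.1 e.dir

theorem near_translate {v : ℤ × ℤ} {e f : GridEdge} :
    Near (translate v e) (translate v f) ↔ Near e f := by
  simp [Near, src_translate, tgt_translate, add_sub_assoc, add_assoc]

theorem touch_translate {v : ℤ × ℤ} {e f : GridEdge} :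
    Touch (translate v e) (translate v f) ↔ Touch e f := by
  simp [Touch, src_translate, tgt_translate]

theorem mem_rim_translate {v : ℤ × ℤ} {e f : GridEdge} :
    translate v f ∈ rim (translate v e) ↔ f ∈ rim e := by
  simp only [mem_rim, near_translate, touch_translate]

theorem mem_nextEdges_translate {v : ℤ × ℤ} {h : List GridEdge} {e f : GridEdge} :
    translate v f ∈ nextEdges (h.map (translate v)) (translate v e) ↔ f ∈ nextEdges h e := by
  simp only [nextEdges, Finset.mem_filter, List.forall_mem_map, mem_rim_translate, near_translate]

theorem card_extensions_translate (v : ℤ × ℤ) (n : ℕ) (h : List GridEdge) (e : GridEdge) :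
    (extensions n (h.map (translate v)) (translate v e)).card = (extensions n h e).card := by
  induction n generalizing h e with
  | zero => rfl
  | succ n ih =>
    rw [card_extensions_succ, card_extensions_succ]
    exact (Finset.sum_equiv (translate v) (fun _ => mem_nextEdges_translate.symm)
      fun f _ => (ih (e :: h) f).symm).symm

theorem card_rim_le (e : GridEdge) : (rim e).card ≤ 10 := by
  obtain ⟨⟨x, y⟩, s⟩ := e
  cases s
  all_goals
    repeat refine (Finset.card_insert_le _ _).trans (Nat.succ_le_succ ?_)
    exact (Finset.card_singleton _).le

theorem card_extensions_zero (h : List GridEdge) (e : GridEdge) : (extensions 0 h e).card = 1 := rfl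

theorem card_extensions_three_le_of_src_eq_zero (s : Bool) :
    ∀ f ∈ rim ((0, 0), s), (extensions 3 [((0, 0), s)] f).card ≤ 261 := by
  simp only [card_extensions_succ, card_extensions_zero, Finset.sum_const, smul_eq_mul, mul_one]
  revert s
  decide +kernel

theorem card_extensions_three_le {e f : GridEdge} (hf : f ∈ rim e) :
    (extensions 3 [e] f).card ≤ 261 := by
  obtain ⟨v, s⟩ := e
  obtain ⟨f, rfl⟩ := (translate v).surjective f
  have he : translate v ((0, 0), s) = (v, s) := Prod.ext (add_zero v) rfl
  rw [← he] at hf ⊢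
  exact (card_extensions_translate v 3 [((0, 0), s)] f).trans_le
    (card_extensions_three_le_of_src_eq_zero s f (mem_rim_translate.1 hf))

theorem card_extensions_three_mul_le (m : ℕ) {e f : GridEdge} (hf : f ∈ rim e) :
    (extensions (3 * m) [e] f).card ≤ 261 ^ m := by
  induction m generalizing e f with
  | zero => simp [extensions]
  | succ m ih =>
    rw [pow_succ']
    exact (card_extensions_add_le (fun _ _ => ih) 2 [e] f).trans
      (Nat.mul_le_mul_right _ (card_extensions_three_le hf))

theorem card_extensions_one_le (h : List GridEdge) (e : GridEdge) :
    (extensions 1 h e).card ≤ 10 := by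
  simp only [card_extensions_succ, card_extensions_zero, Finset.sum_const, smul_eq_mul, mul_one]
  exact (Finset.card_filter_le _ _).trans (card_rim_le e)

theorem card_extensions_three_mul_add_one_le (m : ℕ) (e : GridEdge) :
    (extensions (3 * m + 1) [] e).card ≤ 10 * 261 ^ m :=
  (card_extensions_add_le (fun _ _ => card_extensions_three_mul_le m) 0 [] e).trans
    (Nat.mul_le_mul_right _ (card_extensions_one_le [] e))

/-! ### Parity of dual boundaries -/

/-- The edges with exactly one end in `S`. -/
def edgeBoundary (S : Set (ℤ × ℤ)) : Set GridEdge := {e | ¬ (e.src ∈ S ↔ e.tgt ∈ S)}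

theorem edgeBoundary_finite {S : Set (ℤ × ℤ)} (hS : S.Finite) : (edgeBoundary S).Finite := by
  have hstar : ∀ e ∈ edgeBoundary S, e ∈ ⋃ s : Bool, (·, s) '' S ∪ (· - dir (0, s), s) '' S := by
    rintro ⟨v, s⟩ he
    refine Set.mem_iUnion.2 ⟨s, ?_⟩
    by_cases hv : v ∈ S
    · exact .inl ⟨v, hv, rfl⟩
    · refine .inr ⟨v + dir (0, s), ?_, by simp⟩
      exact (not_iff.1 he).1 hv
  exact (Set.finite_iUnion fun s => (hS.image _).union (hS.image _)).subset hstar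

theorem indicator_edgeBoundary (S : Set (ℤ × ℤ)) (e : GridEdge) :
    (edgeBoundary S).indicator (1 : GridEdge → ZMod 2) e =
      S.indicator 1 e.src + S.indicator 1 e.tgt := by
  have h2 : (1 : ZMod 2) + 1 = 0 := by decide
  by_cases hs : e.src ∈ S <;> by_cases ht : e.tgt ∈ S <;>
    simp [edgeBoundary, hs, ht, h2]

/-- Every unit face is bounded by an even number of edges in `K`: the dual edges form a subgraph
with all degrees even. -/
def EvenOnFaces (K : Set GridEdge) : Prop :=
  ∀ c, ∑ e ∈ face c, K.indicator (1 : GridEdge → ZMod 2) e = 0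

theorem sum_face {M : Type*} [AddCommMonoid M] (k : GridEdge → M) (c : ℤ × ℤ) :
    ∑ e ∈ face c, k e =
      k (c, false) + (k (c + (0, 1), false) + (k (c, true) + k (c + (1, 0), true))) := by
  simp [face, Finset.sum_insert]

theorem evenOnFaces_edgeBoundary (S : Set (ℤ × ℤ)) : EvenOnFaces (edgeBoundary S) := by
  intro c
  have hcomm : c + (1, 0) + (0, 1) = c + (0, 1) + (1, 0) := add_right_comm _ _ _
  simp only [sum_face, indicator_edgeBoundary, src, tgt, dir, cond_true, cond_false, hcomm]
  generalize S.indicator (1 : ℤ × ℤ → ZMod 2) = u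
  linear_combination CharTwo.add_self_eq_zero (u c) + CharTwo.add_self_eq_zero (u (c + (0, 1))) +
    CharTwo.add_self_eq_zero (u (c + (1, 0))) + CharTwo.add_self_eq_zero (u (c + (0, 1) + (1, 0)))

theorem EvenOnFaces.of_link_closed {B K : Set GridEdge} (hB : EvenOnFaces B) (hKB : K ⊆ B)
    (hK : ∀ e ∈ K, ∀ f ∈ B, Link e f → f ∈ K) : EvenOnFaces K := by
  intro c
  by_cases hex : ∃ e ∈ K, e ∈ face c
  · obtain ⟨e, heK, hec⟩ := hex
    rw [← hB c]
    refine Finset.sum_congr rfl fun f hfc => ?_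
    have hf : f ∈ K ↔ f ∈ B := ⟨fun h => hKB h, fun h => hK e heK f h ⟨c, hec, hfc⟩⟩
    by_cases hfB : f ∈ B <;> simp [hf, hfB]
  · exact Finset.sum_eq_zero fun f hfc => Set.indicator_of_notMem (fun hf => hex ⟨f, hf, hfc⟩) _

theorem hasFiniteSupport_indicator_row {K : Set GridEdge} (hK : K.Finite) (y : ℤ) (s : Bool) :
    HasFiniteSupport fun x : ℤ => K.indicator (1 : GridEdge → ZMod 2) ((x, y), s) := by
  have hind : HasFiniteSupport (K.indicator (1 : GridEdge → ZMod 2)) :=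
    hK.subset Set.support_indicator_subset
  exact hind.fun_comp_of_injective fun x x' h => congrArg (·.1.1) h

theorem EvenOnFaces.finsum_row_add_one {K : Set GridEdge} (hK : EvenOnFaces K) (hfin : K.Finite)
    (y : ℤ) :
    ∑ᶠ x : ℤ, K.indicator (1 : GridEdge → ZMod 2) ((x, y + 1), false) =
      ∑ᶠ x : ℤ, K.indicator (1 : GridEdge → ZMod 2) ((x, y), false) := by
  have hvert := finsum_add_one_sub (hasFiniteSupport_indicator_row hfin y true)
  rw [← sub_eq_zero, ← finsum_sub_distrib (hasFiniteSupport_indicator_row hfin _ _)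
    (hasFiniteSupport_indicator_row hfin _ _), ← hvert]
  refine finsum_congr fun x => ?_
  have hface := hK (x, y)
  rw [sum_face] at hface
  simp only [Prod.mk_add_mk, add_zero] at hface
  generalize K.indicator (1 : GridEdge → ZMod 2) = k at hface ⊢
  linear_combination hface - CharTwo.add_self_eq_zero (k ((x, y), false)) -
    CharTwo.add_self_eq_zero (k ((x + 1, y), true))

theorem EvenOnFaces.finsum_row_eq_zero {K : Set GridEdge} (hK : EvenOnFaces K) (hfin : K.Finite)
    (y : ℤ) : ∑ᶠ x : ℤ, K.indicator (1 : GridEdge → ZMod 2) ((x, y), false) = 0 := by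
  have hper : Function.Periodic
      (fun y => ∑ᶠ x : ℤ, K.indicator (1 : GridEdge → ZMod 2) ((x, y), false)) 1 :=
    hK.finsum_row_add_one hfin
  obtain ⟨z, hz⟩ := (hfin.image fun e => e.1.2).exists_notMem
  have hconst := hper.int_mul (y - z) z
  simp only [mul_one, Int.cast_id, add_sub_cancel] at hconst
  rw [hconst]
  exact finsum_eq_zero_of_forall_eq_zero fun x =>
    Set.indicator_of_notMem (fun hx => hz ⟨_, hx, rfl⟩) _

-- Otherwise the only point where membership in the right half of row `0` of `S` changes without
-- an edge of `K` is `0`, whereas a finite set of integers has an even number of ends.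
theorem EvenOnFaces.exists_neg_mem {S : Set (ℤ × ℤ)} {K : Set GridEdge} (hK : EvenOnFaces K)
    (hS : S.Finite) (hfin : K.Finite) (h0 : (0, 0) ∈ S)
    (hright : ∀ x : ℤ, 0 ≤ x → (((x, 0), false) ∈ K ↔ ((x, 0), false) ∈ edgeBoundary S)) :
    ∃ x < 0, ((x, 0), false) ∈ K := by
  classical
  by_contra! hleft
  let k : ℤ → ZMod 2 := fun x => K.indicator 1 ((x, 0), false)
  let u : ℤ → ZMod 2 := fun x => if 0 ≤ x then S.indicator 1 (x, 0) else 0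
  have hk : HasFiniteSupport k := hasFiniteSupport_indicator_row hfin 0 false
  have hu : HasFiniteSupport u := by
    refine (hS.image Prod.fst).subset fun x hx => ⟨(x, 0), ?_, rfl⟩
    by_contra hxS
    simp [u, hxS] at hx
  have hsum : ∑ᶠ x, (k x - (u (x + 1) - u x)) = 0 := by
    rw [finsum_sub_distrib hk ((hu.fun_comp_of_injective (add_left_injective 1)).fun_sub hu),
      finsum_add_one_sub hu, sub_zero]
    exact hK.finsum_row_eq_zero hfin 0
  rw [finsum_eq_single _ (-1)] at hsum
  · simp [k, u, hleft, h0] at hsum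
  intro x hx
  rcases lt_or_ge x 0 with hneg | hnonneg
  · simp [k, u, hleft x hneg, show ¬ 0 ≤ x by omega, show ¬ 0 ≤ x + 1 by omega]
  · have hkx : k x = S.indicator 1 (x, 0) + S.indicator 1 (x + 1, 0) := by
      have hb := indicator_edgeBoundary S ((x, 0), false)
      rw [Set.indicator_apply, ← hright x hnonneg, ← Set.indicator_apply] at hb
      simpa [k, src, tgt, dir] using hb
    have hx1 : 0 ≤ x + 1 := by omega
    simp only [hkx, u, hnonneg, hx1, if_true]
    linear_combination CharTwo.add_self_eq_zero (S.indicator (1 : ℤ × ℤ → ZMod 2) (x, 0))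

theorem exists_boundary_chain {S : Set (ℤ × ℤ)} (hS : S.Finite) (h0 : (0, 0) ∈ S) :
    ∃ x x' : ℤ, 0 ≤ x ∧ x' < 0 ∧ ((x, 0), false) ∈ edgeBoundary S ∧
      Relation.ReflTransGen (fun e f => Link e f ∧ f ∈ edgeBoundary S)
        ((x, 0), false) ((x', 0), false) := by
  set B := edgeBoundary S
  let K : Set GridEdge := {e | ∃ x : ℤ, 0 ≤ x ∧ ((x, 0), false) ∈ B ∧
    Relation.ReflTransGen (fun e f => Link e f ∧ f ∈ B) ((x, 0), false) e}
  have hKB : K ⊆ B := by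
    rintro e ⟨x, -, hxB, hxe⟩
    rcases hxe.cases_tail with rfl | ⟨_, -, -, he⟩
    exacts [hxB, he]
  have hKlink : ∀ e ∈ K, ∀ f ∈ B, Link e f → f ∈ K :=
    fun e ⟨x, hx, hxB, hxe⟩ f hf hef => ⟨x, hx, hxB, hxe.tail ⟨hef, hf⟩⟩
  have hKfin : K.Finite := (edgeBoundary_finite hS).subset hKB
  obtain ⟨x', hx', x, hx, hxB, hxx'⟩ :=
    ((evenOnFaces_edgeBoundary S).of_link_closed hKB hKlink).exists_neg_mem hS hKfin h0
      fun x hx => ⟨fun h => hKB h, fun hxB => ⟨x, hx, hxB, .refl⟩⟩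
  exact ⟨x, x', hx, hx', hxB, hxx'⟩

theorem exists_escaping_edgeBoundary {S : Set (ℤ × ℤ)} (hS : S.Finite) (h0 : (0, 0) ∈ S) :
    ∃ (x : ℕ) (l : List GridEdge), x ≤ l.length ∧ Escaping ((((x : ℤ), 0), false) :: l) ∧
      ∀ e ∈ (((x : ℤ), 0), false) :: l, e ∈ edgeBoundary S := by
  obtain ⟨x, x', hx, hx', hxS, hchain⟩ := exists_boundary_chain hS h0
  lift x to ℕ using hx
  obtain ⟨l, hlS, hesc, hnear⟩ := exists_escaping_of_reachable (edgeBoundary_finite hS) hchain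
  refine ⟨x, l, ?_, hesc, List.forall_mem_cons.2 ⟨hxS, hlS⟩⟩
  have hlast : _ ≤ x' := hnear.sub_one_le
  have hfirst : (x : ℤ) - l.length ≤ _ := hesc.sub_length_le_getLast
  omega

/-! ### The Peierls estimate -/

theorem adj_src_tgt (e : GridEdge) : squareLattice.Adj e.src e.tgt := by
  obtain ⟨v, s⟩ := e
  cases s <;> simp [squareLattice, src, tgt, dir]

/-- The edge of the square lattice that `e` stands for. -/
def toEdge (e : GridEdge) : squareLattice.edgeSet := ⟨s(e.src, e.tgt), e.adj_src_tgt⟩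

theorem touch_of_mem_toEdge {e f : GridEdge} {v : ℤ × ℤ} (he : v ∈ (e.toEdge : Sym2 (ℤ × ℤ)))
    (hf : v ∈ (f.toEdge : Sym2 (ℤ × ℤ))) : Touch e f := by
  rcases Sym2.mem_iff.1 he with rfl | rfl <;> rcases Sym2.mem_iff.1 hf with h | h <;>
    simp [Touch, h]

end GridEdge

open GridEdge

theorem real_forall_closed_le_of_escaping {μ : BondModel squareLattice} {p : ℝ}
    (hμ : μ ∈ oneIndependentModels squareLattice p) {l : List GridEdge} (hl : Escaping l) :
    (μ : Measure (BondConfig squareLattice)).real {ω | ∀ e ∈ l, ω e.toEdge = false} ≤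
      (1 - p) ^ l.length := by
  have hdisj := hl.pairwise_not_touch.imp fun h v he hf => h (touch_of_mem_toEdge (v := v) he hf)
  simpa only [List.forall_mem_map, List.length_map] using
    real_forall_closed_le hμ (List.pairwise_map.2 hdisj)

/-- The event that some escaping sequence of `n + 1` edges that starts with `e` is closed. -/
def closedEscape (n : ℕ) (e : GridEdge) : Set (BondConfig squareLattice) :=
  {ω | ∃ l ∈ extensions n [] e, ∀ f ∈ e :: l, ω f.toEdge = false}

theorem mem_closedEscape {ω : BondConfig squareLattice} {n : ℕ} {e : GridEdge} {l : List GridEdge}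
    (hn : n ≤ l.length) (hesc : Escaping (e :: l)) (hclosed : ∀ f ∈ e :: l, ω f.toEdge = false) :
    ω ∈ closedEscape n e :=
  ⟨l.take n, mem_extensions.2 ⟨List.length_take_of_le hn, hesc.take (n + 1), by simp⟩,
    fun f hf => hclosed f (List.cons_subset_cons e (List.take_subset n l) hf)⟩

theorem real_closedEscape_le {μ : BondModel squareLattice} {p : ℝ}
    (hμ : μ ∈ oneIndependentModels squareLattice p) (n : ℕ) (e : GridEdge) :
    (μ : Measure (BondConfig squareLattice)).real (closedEscape n e) ≤
      (extensions n [] e).card * (1 - p) ^ (n + 1) := by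
  have hunion : closedEscape n e =
      ⋃ l ∈ extensions n [] e, {ω | ∀ f ∈ e :: l, ω f.toEdge = false} := by
    ext ω
    simp only [closedEscape, Set.mem_iUnion, Set.mem_ofPred_eq, exists_prop]
  rw [hunion, ← nsmul_eq_mul]
  refine (measureReal_biUnion_finset_le _ _).trans (Finset.sum_le_card_nsmul _ _ _ fun l hl => ?_)
  obtain ⟨hlen, hesc, -⟩ := mem_extensions.1 hl
  rw [← hlen]
  exact real_forall_closed_le_of_escaping hμ hesc

/-- The event that, for some `x` with `⌈x / 3⌉ = m + 1`, some escaping sequence of `3 * m + 2` edges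
that starts with the horizontal edge at `(x, 0)` is closed. Three values of `x` share one length,
because continuations are counted three edges at a time. -/
def closedEscapeBlock (m : ℕ) : Set (BondConfig squareLattice) :=
  ⋃ x ∈ Finset.Ico (3 * m + 1) (3 * m + 4), closedEscape (3 * m + 1) (((x : ℤ), 0), false)

theorem real_closedEscapeBlock_le {μ : BondModel squareLattice} {p : ℝ}
    (hμ : μ ∈ oneIndependentModels squareLattice p) (m : ℕ) :
    (μ : Measure (BondConfig squareLattice)).real (closedEscapeBlock m) ≤
      30 * (1 - p) ^ 2 * (261 * (1 - p) ^ 3) ^ m := by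
  have hp : 0 ≤ 1 - p :=
    measureReal_nonneg.trans (real_closed_le hμ (toEdge ((0, 0), false)))
  have hescape : ∀ e, (μ : Measure (BondConfig squareLattice)).real (closedEscape (3 * m + 1) e) ≤
      10 * 261 ^ m * (1 - p) ^ (3 * m + 2) := fun e => by
    refine (real_closedEscape_le hμ (3 * m + 1) e).trans ?_
    gcongr
    exact_mod_cast card_extensions_three_mul_add_one_le m e
  calc _ ≤ _ := measureReal_biUnion_finset_le _ _
    _ ≤ (Finset.Ico (3 * m + 1) (3 * m + 4)).card • (10 * 261 ^ m * (1 - p) ^ (3 * m + 2)) :=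
        Finset.sum_le_card_nsmul _ _ _ fun x _ => hescape _
    _ = 30 * (1 - p) ^ 2 * (261 * (1 - p) ^ 3) ^ m := by
        rw [Nat.card_Ico, Nat.add_sub_add_left, nsmul_eq_mul, mul_pow, ← pow_mul]
        push_cast
        ring

theorem exists_mem_closedEscapeBlock {ω : BondConfig squareLattice}
    (hω : ∀ C : (openSubgraph ω).ConnectedComponent, C.supp.Finite) (N : ℕ) :
    ∃ m ≥ N, ω ∈ closedEscapeBlock m := by
  let S : Set (ℤ × ℤ) := ⋃ i ∈ Set.Iic (3 * N + 1),
    ((openSubgraph ω).connectedComponentMk ((i : ℤ), 0)).supp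
  have hS : S.Finite := (Set.finite_Iic _).biUnion fun i _ => hω _
  have hseg : ∀ i : ℕ, i ≤ 3 * N + 1 → ((i : ℤ), 0) ∈ S := fun i hi => Set.mem_biUnion hi rfl
  have hclosed : ∀ e ∈ edgeBoundary S, ω e.toEdge = false := by
    intro e he
    by_contra hopen
    have hadj : (openSubgraph ω).Adj e.src e.tgt :=
      ⟨e.adj_src_tgt, Bool.eq_true_of_not_eq_false hopen⟩
    refine he ?_
    simp only [S, Set.mem_iUnion, SimpleGraph.ConnectedComponent.mem_supp_iff,
      SimpleGraph.ConnectedComponent.sound hadj.reachable]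
  obtain ⟨x, l, hxl, hesc, hlS⟩ := exists_escaping_edgeBoundary hS (hseg 0 (Nat.zero_le _))
  have hx : 3 * N + 1 ≤ x := by
    by_contra! hlt
    refine hlS _ List.mem_cons_self (iff_of_true (hseg x hlt.le) ?_)
    simpa [tgt, dir] using hseg (x + 1) hlt
  have hIco : x ∈ Finset.Ico (3 * ((x - 1) / 3) + 1) (3 * ((x - 1) / 3) + 4) :=
    Finset.mem_Ico.2 (by omega)
  have hmem := mem_closedEscape ((Finset.mem_Ico.1 hIco).1.trans hxl) hesc
    fun e he => hclosed e (hlS e he)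
  exact ⟨(x - 1) / 3, by omega, Set.mem_iUnion₂.2 ⟨x, hIco, hmem⟩⟩

theorem ae_exists_infinite_cluster {μ : BondModel squareLattice} {p : ℝ}
    (hp : 261 * (1 - p) ^ 3 < 1) (hμ : μ ∈ oneIndependentModels squareLattice p) :
    ∀ᵐ ω ∂(μ : Measure (BondConfig squareLattice)),
      ∃ C : (openSubgraph ω).ConnectedComponent, C.supp.Infinite := by
  have hp1 : 0 ≤ 1 - p :=
    measureReal_nonneg.trans (real_closed_le hμ (toEdge ((0, 0), false)))
  have hsummable : Summable fun m =>
      (μ : Measure (BondConfig squareLattice)).real (closedEscapeBlock m) :=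
    ((summable_geometric_of_lt_one (by positivity) hp).mul_left (30 * (1 - p) ^ 2)).of_nonneg_of_le
      (fun _ => measureReal_nonneg) (real_closedEscapeBlock_le hμ)
  have hsum : ∑' m, (μ : Measure (BondConfig squareLattice)) (closedEscapeBlock m) ≠ ⊤ := by
    simpa using hsummable.tsum_ofReal_ne_top
  filter_upwards [ae_eventually_notMem hsum] with ω hω
  by_contra! hfin
  obtain ⟨N, hN⟩ := Filter.eventually_atTop.1 hω
  obtain ⟨m, hm, hmem⟩ := exists_mem_closedEscapeBlock hfin N
  exact hN m hm hmem

end Percolation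

theorem theorem1p1_general {p : ℝ} (hp : 261 * (1 - p) ^ 3 < 1) :
    (∀ μ ∈ Percolation.oneIndependentModels Percolation.squareLattice p,
      Percolation.Percolates μ) ∧
    Percolation.pMax Percolation.squareLattice ≤ p := by
  have hperc : ∀ μ ∈ Percolation.oneIndependentModels Percolation.squareLattice p,
      Percolation.Percolates μ := fun μ hμ =>
    Percolation.percolates_of_ae (Percolation.ae_exists_infinite_cluster hp hμ)
  refine ⟨hperc, Percolation.pMax_le ?_ hperc⟩
  by_contra! hneg
  nlinarith [pow_le_pow_left₀ (by norm_num) (show 1 ≤ 1 - p by linarith) 3]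

theorem theorem1p1 :
    (∀ μ ∈ Percolation.oneIndependentModels Percolation.squareLattice 0.8457,
      Percolation.Percolates μ) ∧
    Percolation.pMax Percolation.squareLattice ≤ 0.8457 :=
  theorem1p1_general (by norm_num)
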